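/- Conventions. An algebra is a nonempty set with finitely many finitary basic operations. For a finite algebra $\mathbf A$ and $n\ge 1$, let $\mathscr V(\mathbf A)^{(n)}$ be the class of all algebras in the signature of $\mathbf A$ that satisfy every identity in at most $n$ variables that is valid in $\mathbf A$. An algebra is $d$-generated if it is generated by some set of at most $d$ of its elements. A finite algebra $\mathbf A$ is inherently nonfinitely based in the finite sense ($\mathrm{INFB}_{\mathrm{fin}}$) if for every $n\ge 1$ there exists $d\ge 1$ such that $\mathscr V(\mathbf A)^{(n)}$ contains arbitrarily large finite $d$-generated algebras. Theorem. Let $G$ be a finite non-nilpotent group and let $\alpha\colon G\times S\to S$, $(g,x)\mapsto gx$, be a faithful left action of $G$ on a finite set $S$. Let $G^0=G\sqcup\{0\}$ and $S^0=S\sqcup\{0\}$ be obtained by adjoining a new element $0$ to each of $G$ and $S$, and let $\alpha^0\colon G^0\times S^0\to S^0$ be the extension of $\alpha$ with $\alpha^0(g,x)=0$ whenever $g=0$ or $x=0$. Let $\mathbb A^0(G,S,\alpha)^\ast$ be the algebra with universe $G^0\times S^0$ and two basic operations, the unary operation $f$ and the binary operation $d$ given by $$f\bigl((a_1,a_2)\bigr)=\bigl(a_1,\alpha^0(a_1,a_2)\bigr),\qquad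 d\bigl((a_1,a_2),(b_1,b_2)\bigr)=(a_1,b_2).$$ Then $\mathbb A^0(G,S,\alpha)^\ast$ is $\mathrm{INFB}_{\mathrm{fin}}$. -/

import Mathlib

universe u v w

namespace UnivAlg

/-! ### Identities and varieties (algebras = structures over a language without relation symbols) -/

section Varieties

variable (L : FirstOrder.Language.{u, v}) [L.IsAlgebraic]

/-- The identity `s ≈ t` is valid in the algebra `M`. -/
def Satisfies (M : Type*) [L.Structure M] {α : Type*} (s t : L.Term α) : Prop :=
  ∀ x : α → M, s.realize x = t.realize x

/-- `M` belongs to `𝒱(A)⁽ⁿ⁾`, the class of all models of the set of identities in at most `n`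
variables that are valid in `A`. -/
def MemVarietyN (A : Type*) [L.Structure A] (n : ℕ) (M : Type*) [L.Structure M] : Prop :=
  ∀ s t : L.Term (Fin n), Satisfies L A s t → Satisfies L M s t

/-- `M` is generated, as an algebra, by some set of at most `d` elements. -/
def IsGeneratedBy (d : ℕ) (M : Type*) [L.Structure M] : Prop :=
  ∃ X : Finset M, X.card ≤ d ∧ FirstOrder.Language.Substructure.closure L (X : Set M) = ⊤

/-- `A` is a finite algebra with finitely many basic operations, and it is inherently nonfinitely
based in the finite sense: for every `n ≥ 1` there is `d ≥ 1` such that `𝒱(A)⁽ⁿ⁾` contains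
arbitrarily large finite `d`-generated algebras. (Every finite algebra is isomorphic to one whose
universe lies in `Type`, so the witnesses may be taken there.) -/
def IsINFBfin (A : Type w) [L.Structure A] : Prop :=
  Finite (Σ k, L.Functions k) ∧ Finite A ∧
    ∀ n : ℕ, 1 ≤ n → ∃ d : ℕ, 1 ≤ d ∧ ∀ l : ℕ,
      ∃ (M : Type) (_ : L.Structure M),
        Finite M ∧ l ≤ Nat.card M ∧ IsGeneratedBy L d M ∧ MemVarietyN L A n M

end Varieties

/-! ### Two-sorted algebras with one operation of type `1 × 2 → 2` -/

set_option linter.checkUnivs false in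
/-- A 2-sorted algebra `(A₁, A₂; s)` with one operation `s : A₁ × A₂ → A₂`. -/
structure TwoSorted where
  /-- the first universe -/
  fst : Type u
  /-- the second universe -/
  snd : Type v
  /-- the operation -/
  op : fst → snd → snd

namespace TwoSorted

/-- The 2-sorted algebra `(G, S; α)` of a group action, `α (g, x) = g • x`. -/
def ofAction (G : Type u) (S : Type v) [Group G] [MulAction G S] : TwoSorted.{u, v} where
  fst := G
  snd := S
  op g x := g • x

/-- `B⁰`: a new element `0` is adjoined to each universe, and the operation is extended by
`s⁰ (b, b') = 0` as soon as `b = 0` or `b' = 0`. -/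
def adjoinZero (B : TwoSorted.{u, v}) : TwoSorted.{u, v} where
  fst := WithZero B.fst
  snd := WithZero B.snd
  op := WithZero.map₂ B.op

/-- The universe `A₁ × A₂` of the 1-sorted version `A*` of a 2-sorted algebra. -/
def Star (A : TwoSorted.{u, v}) : Type (max u v) := A.fst × A.snd

end TwoSorted

/-! ### The 1-sorted version of a 2-sorted algebra -/

/-- The operation symbols of the 1-sorted signature: `f` (unary) and `d` (binary). -/
inductive StarFunc : ℕ → Type
  | f : StarFunc 1
  | d : StarFunc 2

/-- The signature `{d, f}` of 1-sorted algebras. -/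
def starLang : FirstOrder.Language.{0, 0} where
  Functions := StarFunc
  Relations := fun _ => Empty

instance : starLang.IsAlgebraic := fun _ => inferInstanceAs (IsEmpty Empty)

/-- `A*` as an algebra: `f (a₁, a₂) = (a₁, s (a₁, a₂))` and `d ((a₁, a₂), (b₁, b₂)) = (a₁, b₂)`. -/
instance TwoSorted.starStructure (A : TwoSorted.{u, v}) : starLang.Structure A.Star where
  funMap {_} F :=
    match F with
    | StarFunc.f => fun x => ((x 0).1, A.op (x 0).1 (x 0).2)
    | StarFunc.d => fun x => ((x 0).1, (x 1).2)
  RelMap {_} r := nomatch r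

end UnivAlg

/-! A term in `d` and `f` only remembers an outer variable, an inner variable and a word in the
variables acting on the latter. The adjoined zeros make both variables visible, so every identity of
the algebra comes from a positive law of `G`.

Non-nilpotency constrains these laws. Some section of `G` has an elementary abelian normal
`p`-subgroup on which an element `g` acts with prime order `q ≠ p`. Sending letters to powers of `g`
or to elements of this subgroup and inverting a Fourier transform, one recovers from a word its
letter counts mod `q` and, for each suffix shift, the number mod `p` of occurrences of a marked
letter (`exists_balanced`).

The witnesses are automata with `m + 2` letters and arbitrarily many states. Words omitting some
translation letter act through these counts alone, and `m` variables cannot name all `m + 1`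
translations; hence all `m`-variable identities hold (`automaton_memVarietyN`). All letters together
act transitively, so the number of generators does not grow with the state set
(`automaton_isGeneratedBy`). -/

namespace WordLaw

/-! ### Positive laws, letter counts and Fourier inversion -/

/-- The group (or monoid) `H` satisfies the positive law `u = v`. -/
def Law (H : Type*) [Monoid H] {α : Type*} (u v : List α) : Prop :=
  ∀ φ : α → H, (u.map φ).prod = (v.map φ).prod

theorem Law.of_injective {H K α : Type*} [Monoid H] [Monoid K] (f : K →* H)
    (hf : Function.Injective f) {u v : List α} (h : Law H u v) : Law K u v := fun φ => by
  apply hf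
  have := h (fun i => f (φ i))
  simpa [map_list_prod, List.map_map, Function.comp_def] using this

theorem Law.of_surjective {H K α : Type*} [Monoid H] [Monoid K] (f : H →* K)
    (hf : Function.Surjective f) {u v : List α} (h : Law H u v) : Law K u v := fun φ => by
  choose g hg using hf
  have := congrArg f (h (fun i => g (φ i)))
  simpa [map_list_prod, List.map_map, Function.comp_def, hg] using this

section Shift

variable {I : Type*} [DecidableEq I] (q : ℕ)

/-- The number of occurrences of each letter `some i`, modulo `q`. -/
def shift : List (Option I) → I → ZMod q
  | [] => 0
  | none :: W => shift W
  | some i :: W => Pi.single i 1 + shift W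

/-- The number of occurrences of `none` followed by a suffix with shift `τ`. -/
def occ [Fintype I] (τ : I → ZMod q) : List (Option I) → ℕ
  | [] => 0
  | none :: W => occ τ W + if shift q W = τ then 1 else 0
  | some _ :: W => occ τ W

end Shift

/-- The words `u`, `v` cannot be told apart, after any substitution of letters, by the shift modulo
`q` and by the number modulo `p` of occurrences of `none` at a given shift. -/
def Balanced (p q : ℕ) {α : Type*} (u v : List α) : Prop :=
  ∀ (m : ℕ) (ρ : α → Option (Fin m)), shift q (u.map ρ) = shift q (v.map ρ) ∧
    ∀ τ, occ q τ (u.map ρ) ≡ occ q τ (v.map ρ) [MOD p]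

open Matrix in
/-- Fourier inversion over `(ℤ/q)^I` with values in a `p`-torsion group. -/
theorem dvd_of_sum_smul_eq_zero {I V : Type*} [Fintype I] [DecidableEq I] [AddCommGroup V]
    {p q : ℕ} [hp : Fact p.Prime] [hq : Fact q.Prime] (hpq : p ≠ q) (E : ZMod q → V)
    (hE : ∑ z, E z = 0) (hpE : ∀ z, p • E z = 0) (hE0 : E 0 ≠ 0) (D : (I → ZMod q) → ℤ)
    (h : ∀ (c : I → ZMod q) (w : ZMod q), ∑ τ, D τ • E (c ⬝ᵥ τ + w) = 0) (σ : I → ZMod q) :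
    (p : ℤ) ∣ D σ := by
  -- Translating `c` shifts `c ⬝ᵥ δ` by any residue, so `q` times the sum splits into full sums of
  -- `E` and vanishes. So does `p` times it, and `p`, `q` are coprime.
  have hX : ∀ δ : I → ZMod q, δ ≠ 0 → ∑ c : I → ZMod q, E (c ⬝ᵥ δ) = 0 := by
    intro δ hδ
    obtain ⟨i, hi⟩ := Function.ne_iff.mp hδ
    set X := ∑ c : I → ZMod q, E (c ⬝ᵥ δ) with hXdef
    have h1 : q • X = 0 := by
      have h2 : ∀ z : ZMod q, X = ∑ c : I → ZMod q, E (c ⬝ᵥ δ + z) := by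
        intro z
        rw [hXdef]
        refine (Fintype.sum_equiv (Equiv.addRight (Pi.single i (z * (δ i)⁻¹))) _ _ ?_).symm
        intro c
        simp only [Equiv.coe_addRight, add_dotProduct, single_dotProduct]
        rw [mul_assoc, inv_mul_cancel₀ hi, mul_one]
      have h3 : ∑ z : ZMod q, X = q • X := by simp [ZMod.card]
      rw [← h3, Finset.sum_congr rfl (fun z _ => h2 z), Finset.sum_comm]
      refine Finset.sum_eq_zero fun c _ => ?_
      rw [← hE]
      exact Fintype.sum_equiv (Equiv.addLeft (c ⬝ᵥ δ)) _ _ (fun _ => rfl)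
    have h2 : p • X = 0 := by
      rw [hXdef, Finset.smul_sum]
      exact Finset.sum_eq_zero fun c _ => hpE _
    have hco : Nat.Coprime p q := (Nat.coprime_primes hp.out hq.out).2 hpq
    have h4 : addOrderOf X ∣ 1 := by
      rw [← Nat.Coprime.gcd_eq_one hco]
      exact Nat.dvd_gcd (addOrderOf_dvd_of_nsmul_eq_zero h2) (addOrderOf_dvd_of_nsmul_eq_zero h1)
    exact AddMonoid.addOrderOf_eq_one_iff.mp (Nat.dvd_one.mp h4)
  -- With `w = -(c ⬝ᵥ σ)`, only `τ = σ` survives summation over `c`, leaving a power of `q` times `D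
  -- σ • E 0`.
  have hsum : ∑ c : I → ZMod q, ∑ τ, D τ • E (c ⬝ᵥ τ + -(c ⬝ᵥ σ)) = 0 :=
    Finset.sum_eq_zero fun c _ => h c _
  rw [Finset.sum_comm, Finset.sum_eq_single σ] at hsum
  · simp only [add_neg_cancel, Finset.sum_const, Finset.card_univ] at hsum
    rw [← natCast_zsmul, smul_smul] at hsum
    have hord : addOrderOf (E 0) = p := addOrderOf_eq_prime (hpE 0) hE0
    have h5 := addOrderOf_dvd_iff_zsmul_eq_zero.mpr hsum
    rw [hord, Fintype.card_fun, ZMod.card] at h5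
    rcases (Nat.prime_iff_prime_int.mp hp.out).dvd_or_dvd h5 with h6 | h6
    · exfalso
      have := hp.out.dvd_of_dvd_pow (Int.natCast_dvd_natCast.mp h6)
      exact hpq ((Nat.prime_dvd_prime_iff_eq hp.out hq.out).mp this)
    · exact h6
  · intro τ _ hτ
    rw [← Finset.smul_sum]
    have := hX (τ - σ) (sub_ne_zero.mpr hτ)
    simp only [dotProduct_sub] at this
    simp only [← sub_eq_add_neg]
    rw [this, smul_zero]
  · simp

/-! ### Values of words in a group with an abelian normal subgroup -/

section Evaluation

open Matrix

variable {I : Type*} [Fintype I] [DecidableEq I] {q : ℕ} [NeZero q]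

/-- The exponent of `g` in the value of a word under `some i ↦ g ^ c i`. -/
def expo (c : I → ZMod q) (W : List (Option I)) : ℕ :=
  (W.map fun a => a.elim 0 fun i => (c i).val).sum

theorem expo_cast (c : I → ZMod q) (W : List (Option I)) :
    (expo c W : ZMod q) = c ⬝ᵥ shift q W := by
  induction W with
  | nil => simp [expo, shift]
  | cons a W ih =>
    cases a with
    | none => simpa [expo, shift] using ih
    | some i =>
      have : expo c (some i :: W) = (c i).val + expo c W := by simp [expo]
      rw [this]
      simp [shift, dotProduct_add, ih]

omit [Fintype I] [DecidableEq I] [NeZero q] in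
theorem prod_map_elim_one {H : Type*} [Group H] (g : H) (c : I → ZMod q) (W : List (Option I)) :
    (W.map fun a => a.elim 1 fun i => g ^ (c i).val).prod = g ^ expo c W := by
  induction W with
  | nil => simp [expo]
  | cons a W ih => cases a <;> simp [expo, ih, pow_add]

/-- Pulling all powers of `g` to the left moves each value of `none` past the power of `g` produced
by the suffix behind it. By `expo_cast` this adds `c ⬝ᵥ τ` to its index, with `τ` the shift of that
suffix. -/
theorem prod_map_elim {H : Type*} [Group H]
    {V : Type*} [AddCommGroup V] (ι : Multiplicative V →* H) (g : H)
    (E : ZMod q → V)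
    (hE : ∀ z, ι (.ofAdd (E z)) * g = g * ι (.ofAdd (E (z + 1)))) (c : I → ZMod q) (w : ZMod q)
    (W : List (Option I)) :
    (W.map fun a => a.elim (ι (.ofAdd (E w))) fun i => g ^ (c i).val).prod =
      g ^ expo c W * ι (.ofAdd (∑ τ, occ q τ W • E (c ⬝ᵥ τ + w))) := by
  have hpow : ∀ (k : ℕ) z, ι (.ofAdd (E z)) * g ^ k = g ^ k * ι (.ofAdd (E (z + k))) := by
    intro k
    induction k with
    | zero => simp
    | succ k ih =>
      intro z
      rw [pow_succ, ← mul_assoc, ih, mul_assoc, hE, mul_assoc]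
      push_cast
      rw [add_assoc]
  induction W with
  | nil => simp [expo, occ]
  | cons a W ih =>
    rw [List.map_cons, List.prod_cons, ih]
    cases a with
    | none =>
      have h1 : expo c (none :: W) = expo c W := by simp [expo]
      have h2 : ∑ τ, occ q τ (none :: W) • E (c ⬝ᵥ τ + w) =
          E (w + expo c W) + ∑ τ, occ q τ W • E (c ⬝ᵥ τ + w) := by
        simp only [occ, add_smul, Finset.sum_add_distrib, ite_smul, one_smul, zero_smul,
          Finset.sum_ite_eq, Finset.mem_univ, if_true, expo_cast]
        rw [add_comm, add_comm w]
      rw [h1, h2, ofAdd_add, map_mul, ← mul_assoc, ← mul_assoc]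
      simp only [Option.elim_none]
      rw [hpow]
    | some i =>
      have h1 : expo c (some i :: W) = (c i).val + expo c W := by simp [expo]
      rw [h1, pow_add, mul_assoc]
      rfl

end Evaluation

open Matrix in
/-- If a group has an abelian normal subgroup of exponent `p` on which some element acts with
prime order `q ≠ p`, then its positive laws are balanced. -/
theorem Law.balanced_of_normal {H : Type*} [Group H] (A : Subgroup H) [hn : A.Normal]
    {p q : ℕ} [hp : Fact p.Prime] [hq : Fact q.Prime] (hpq : p ≠ q)
    (hcomm : ∀ x ∈ A, ∀ y ∈ A, x * y = y * x) (hexp : ∀ x ∈ A, x ^ p = 1)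
    (g : H) (hg : ∀ x ∈ A, g ^ q * x = x * g ^ q) (hne : ∃ x ∈ A, g * x ≠ x * g)
    {α : Type*} {u v : List α} (h : Law H u v) : Balanced p q u v := by
  intro m ρ
  have h' : Law H (u.map ρ) (v.map ρ) := fun φ => by
    simpa [List.map_map] using h (φ ∘ ρ)
  generalize u.map ρ = u' at *
  generalize v.map ρ = v' at *
  obtain ⟨x, hx, hxg⟩ := hne
  -- Otherwise `g` is a power of `g ^ q` and commutes with `x`.
  have hqg : q ∣ orderOf g := by
    by_contra hnd
    have hco : (orderOf g).Coprime q := ((Nat.Prime.coprime_iff_not_dvd hq.out).mpr hnd).symm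
    obtain ⟨k, hk⟩ := exists_pow_eq_self_of_coprime hco.symm
    apply hxg
    have hc : Commute (g ^ q) x := hg x hx
    have := hc.pow_left k
    rwa [hk] at this
  have hexpo : ∀ c : Fin m → ZMod q, g ^ expo c u' = g ^ expo c v' := by
    intro c
    rw [← prod_map_elim_one, ← prod_map_elim_one]
    exact h' _
  refine ⟨?_, fun σ => ?_⟩
  · ext i
    have h1 := pow_eq_pow_iff_modEq.mp (hexpo (Pi.single i 1))
    have h2 := (ZMod.natCast_eq_natCast_iff _ _ _).mpr (h1.of_dvd hqg)
    simpa [expo_cast] using h2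
  let _ : CommGroup A := { (inferInstance : Group A) with
    mul_comm := fun a b => Subtype.ext (hcomm a a.2 b b.2) }
  have hmem : ∀ k : ℕ, (g ^ k)⁻¹ * x * g ^ k ∈ A := fun k => by
    simpa using hn.conj_mem _ hx (g ^ k)⁻¹
  let X : ZMod q → Additive A := fun z => .ofMul ⟨_, hmem z.val⟩
  have hper : Function.Periodic (fun k : ℕ => (g ^ k)⁻¹ * x * g ^ k) q := fun k => by
    have h1 := hg _ (hmem k)
    simp only [pow_add, _root_.mul_inv_rev, mul_assoc] at h1 ⊢
    rw [← h1, inv_mul_cancel_left]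
  have hX : ∀ k : ℕ, ((X k).toMul : H) = (g ^ k)⁻¹ * x * g ^ k := fun k => by
    rw [← hper.map_mod_nat k]
    simp [X, ZMod.val_natCast]
  have hXg : ∀ z, ((X z).toMul : H) * g = g * ((X (z + 1)).toMul : H) := fun z => by
    obtain ⟨k, rfl⟩ := ZMod.natCast_zmod_surjective z
    have := hX (k + 1)
    push_cast at this
    rw [this, hX, pow_succ', mul_assoc, ← pow_succ, pow_succ']
    simp only [mul_assoc, _root_.mul_inv_rev]
    rw [(Commute.refl g).pow_right k |>.inv_right.left_comm]
    simp
  -- Differences of conjugates telescope to total zero, as Fourier inversion requires, while `E 0 ≠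
  -- 0` because `g` and `x` do not commute.
  let E : ZMod q → Additive A := fun z => X z - X (z + 1)
  let ι : Multiplicative (Additive A) →* H :=
    A.subtype.comp (MulEquiv.multiplicativeAdditive A).toMonoidHom
  have hι : Function.Injective ι :=
    A.subtype_injective.comp (MulEquiv.multiplicativeAdditive A).injective
  have hιE : ∀ z, ι (.ofAdd (E z)) * g = g * ι (.ofAdd (E (z + 1))) := fun z => by
    have h1 : ((X (z + 1)).toMul : H)⁻¹ * g = g * ((X (z + 1 + 1)).toMul : H)⁻¹ := by
      rw [inv_mul_eq_iff_eq_mul, ← mul_assoc, hXg, mul_inv_cancel_right]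
    have h2 : ∀ z, ι (.ofAdd (E z)) = ((X z).toMul : H) * ((X (z + 1)).toMul : H)⁻¹ := fun z => by
      rw [← div_eq_mul_inv]; rfl
    rw [h2, h2, mul_assoc, h1, ← mul_assoc, hXg, mul_assoc]
  have hEsum : ∑ z, E z = 0 := by
    simp only [E, Finset.sum_sub_distrib]
    rw [sub_eq_zero]
    exact (Fintype.sum_equiv (Equiv.addRight (1 : ZMod q)) _ _ (fun _ => rfl)).symm
  have hpE : ∀ z, p • E z = 0 := fun z => by
    apply Additive.toMul.injective
    apply Subtype.ext
    simpa using hexp _ (E z).toMul.2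
  have hE0 : E 0 ≠ 0 := by
    intro h0
    have h1 : X 0 = X (0 + 1) := sub_eq_zero.mp h0
    have h2 := hXg 0
    rw [← h1] at h2
    have h3 := hX 0
    simp only [Nat.cast_zero, pow_zero, inv_one, one_mul, mul_one] at h3
    rw [h3] at h2
    exact hxg h2.symm
  have hdvd := dvd_of_sum_smul_eq_zero hpq E hEsum hpE hE0
    (fun τ => (occ q τ v' : ℤ) - occ q τ u') (fun c w => ?_) σ
  · exact (Nat.modEq_iff_dvd).mpr hdvd
  · have h1 := h' fun a => a.elim (ι (.ofAdd (E w))) fun i => g ^ (c i).val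
    rw [prod_map_elim ι g E hιE, prod_map_elim ι g E hιE, hexpo c, mul_right_inj] at h1
    have h2 : _ = _ := Multiplicative.ofAdd.injective (hι h1)
    simp only [sub_smul, Finset.sum_sub_distrib, natCast_zsmul]
    rw [h2, sub_self]

end WordLaw

/-! ### Minimal non-nilpotent finite groups -/

namespace MinimalNonnilpotent

open Group

variable {G : Type u} [Group G] [Finite G]

/-- In a finite group without proper nontrivial normal subgroups all of whose proper subgroups are
nilpotent, distinct maximal subgroups intersect trivially. -/
theorem inf_eq_bot_of_isCoatom (hsub : ∀ K : Subgroup G, K ≠ ⊤ → IsNilpotent K)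
    (hsimple : ∀ N : Subgroup G, N.Normal → N = ⊥ ∨ N = ⊤) (M : Subgroup G) :
    ∀ N : Subgroup G, IsCoatom M → IsCoatom N → M ≠ N → M ⊓ N = ⊥ := by
  by_contra! hcon
  let P : Subgroup G → Prop := fun I =>
    I ≠ ⊥ ∧ ∃ M N : Subgroup G, IsCoatom M ∧ IsCoatom N ∧ M ≠ N ∧ M ⊓ N = I
  obtain ⟨I, hI⟩ : ∃ I, Maximal P I := by
    obtain ⟨N, hM, hN, hMN, h⟩ := hcon
    exact (Set.toFinite {I | P I}).exists_maximal ⟨_, h, M, N, hM, hN, hMN, rfl⟩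
  obtain ⟨⟨hI0, M, N, hM, hN, hMN, hinf⟩, hmax⟩ := hI
  have hIM : I ≤ M := hinf ▸ inf_le_left
  have hIN : I ≤ N := hinf ▸ inf_le_right
  have hnorm : Subgroup.normalizer (I : Set G) ≠ ⊤ := by
    intro h
    rcases hsimple I (Subgroup.normalizer_eq_top_iff.mp h) with h | h
    · exact hI0 h
    · exact hM.1 (top_le_iff.mp (h ▸ hIM))
  obtain ⟨L, hL, hnL⟩ := (eq_top_or_exists_le_coatom (Subgroup.normalizer (I : Set G))).resolve_left
    hnorm
  -- In the nilpotent group `K`, the normalizer of `I` is strictly larger than `I`. Thus `L ⊓ K`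
  -- exceeds `I`, and maximality of `I` among intersections of distinct maximal subgroups forces `L
  -- = K`.
  have key : ∀ K : Subgroup G, IsCoatom K → I < K → L = K := by
    intro K hK hIK
    by_contra hne
    have hnil := hsub K hK.1
    have hlt : I.subgroupOf K < ⊤ := by
      rw [lt_top_iff_ne_top, Ne, Subgroup.subgroupOf_eq_top]
      exact hIK.not_ge
    obtain ⟨x, hx, hxI⟩ := SetLike.exists_of_lt (Group.normalizerCondition_of_isNilpotent _ hlt)
    have hxn : (x : G) ∈ Subgroup.normalizer (I : Set G) := by
      rw [Subgroup.mem_normalizer_iff] at hx ⊢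
      intro h
      constructor
      · intro hh
        have := (hx ⟨h, hIK.le hh⟩).mp (by simpa [Subgroup.mem_subgroupOf] using hh)
        simpa [Subgroup.mem_subgroupOf] using this
      · intro hh
        have h1 : h ∈ K := by
          have := K.mul_mem (K.mul_mem (K.inv_mem x.2) (hIK.le hh)) x.2
          simpa [mul_assoc] using this
        exact (hx ⟨h, h1⟩).mpr (by simpa [Subgroup.mem_subgroupOf] using hh)
    have hle : I ≤ L ⊓ K := le_inf (Subgroup.le_normalizer.trans hnL) hIK.le
    have hP : P (L ⊓ K) := ⟨ne_bot_of_le_ne_bot hI0 hle, L, K, hL, hK, hne, rfl⟩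
    exact hxI (hmax hP hle ⟨hnL hxn, x.2⟩)
  have hlt : ∀ K K' : Subgroup G, IsCoatom K → IsCoatom K' → K ≠ K' → I ≤ K → I ≤ K' →
      K ⊓ K' = I → I < K := by
    intro K K' hK hK' hne h1 h2 h
    refine lt_of_le_of_ne h1 fun heq => hne ?_
    have h3 : K ≤ K' := by rw [← heq]; exact h2
    exact (hK.le_iff_eq hK'.1).mp h3 |>.symm
  exact hMN ((key M hM (hlt M N hM hN hMN hIM hIN hinf)).symm.trans
    (key N hN (hlt N M hN hM hMN.symm hIN hIM (inf_comm M N ▸ hinf))))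

open Pointwise in
/-- A finite nonnilpotent group all of whose proper subgroups are nilpotent has a proper nontrivial
normal subgroup. -/
theorem exists_normal (hG : ¬ IsNilpotent G) (hsub : ∀ K : Subgroup G, K ≠ ⊤ → IsNilpotent K) :
    ∃ N : Subgroup G, N.Normal ∧ N ≠ ⊥ ∧ N ≠ ⊤ := by
  classical
  by_contra! hcon
  have hsimple : ∀ N : Subgroup G, N.Normal → N = ⊥ ∨ N = ⊤ := fun N hN => by
    by_cases h : N = ⊥
    · exact .inl h
    · exact .inr (hcon N hN h)
  have hinter := inf_eq_bot_of_isCoatom hsub hsimple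
  have hcoatom : ∀ x : G, ∃ M : Subgroup G, IsCoatom M ∧ x ∈ M := by
    intro x
    rcases eq_top_or_exists_le_coatom (Subgroup.zpowers x) with h | ⟨M, hM, hx⟩
    · exfalso
      apply hG
      have : IsCyclic G := ⟨x, fun y => by
        have : y ∈ Subgroup.zpowers x := h ▸ Subgroup.mem_top y
        exact this⟩
      let _ : CommGroup G := IsCyclic.commGroup
      infer_instance
    · exact ⟨M, hM, hx (Subgroup.mem_zpowers x)⟩
  have hself : ∀ M : Subgroup G, IsCoatom M → M ≠ ⊥ → Subgroup.normalizer (M : Set G) = M := by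
    intro M hM hM0
    rcases hM.le_iff.mp (Subgroup.le_normalizer (H := M)) with h | h
    · rcases hsimple M (Subgroup.normalizer_eq_top_iff.mp h) with h | h
      · exact absurd h hM0
      · exact absurd h hM.1
    · exact h
  -- conjugates of nonidentity elements of a maximal subgroup, each listed once
  let F : ∀ M : Subgroup G, (G ⧸ M) × {x : M // x ≠ 1} → G :=
    fun M y => y.1.out * (y.2.1 : G) * y.1.out⁻¹
  have hconj : ∀ (M : Subgroup G) (g : G), IsCoatom M → IsCoatom (MulAut.conj g • M) :=
    fun M g hM => ((MulAut.conj g).mapSubgroup.isCoatom_iff M).mpr hM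
  have hmem : ∀ {M N : Subgroup G} {a b : G}, MulAut.conj a • M = MulAut.conj b • N →
      ∀ x, a⁻¹ * x * a ∈ M ↔ b⁻¹ * x * b ∈ N := by
    intro M N a b h x
    have := SetLike.ext_iff.mp h x
    simpa [Subgroup.mem_pointwise_smul_iff_inv_smul_mem, ← map_inv, MulAut.conj_apply] using this
  have hF1 : ∀ M y, F M y ≠ 1 := by
    intro M y h
    have : (y.2.1 : G) = 1 := by simpa [F] using h
    exact y.2.2 (Subtype.ext this)
  have hF : ∀ (M N : Subgroup G) y z, IsCoatom M → IsCoatom N → F M y = F N z →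
      MulAut.conj y.1.out • M = MulAut.conj z.1.out • N := by
    intro M N y z hM hN h
    by_contra hne
    have := hinter _ _ (hconj M y.1.out hM) (hconj N z.1.out hN) hne
    have h1 : F M y ∈ MulAut.conj y.1.out • M ⊓ MulAut.conj z.1.out • N := by
      refine ⟨?_, ?_⟩
      · exact Subgroup.smul_mem_pointwise_smul _ _ _ y.2.1.2
      · rw [h]; exact Subgroup.smul_mem_pointwise_smul _ _ _ z.2.1.2
    rw [this, Subgroup.mem_bot] at h1
    exact hF1 _ _ h1
  have hFinj : ∀ M : Subgroup G, IsCoatom M → M ≠ ⊥ → Function.Injective (F M) := by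
    intro M hM hM0 y z h
    have h1 := hF M M y z hM hM h
    have h2 : y.1 = z.1 := by
      rw [← Quotient.out_eq y.1, ← Quotient.out_eq z.1]
      apply QuotientGroup.eq.mpr
      have : (y.1.out)⁻¹ * z.1.out ∈ Subgroup.normalizer (M : Set G) := by
        rw [Subgroup.mem_normalizer_iff]
        intro x
        have := hmem h1 (z.1.out * x * z.1.out⁻¹)
        simp only [mul_assoc, inv_mul_cancel, inv_mul_cancel_left, mul_one, mul_inv_rev,
          inv_inv] at this ⊢
        exact this.symm
      rwa [hself M hM hM0] at this
    have h3 : (y.2.1 : G) = z.2.1 := by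
      simp only [F, h2] at h
      exact mul_left_cancel (mul_right_cancel h)
    exact Prod.ext h2 (Subtype.ext (Subtype.ext h3))
  -- The conjugates of `M` contain at least half of `|G|` nonidentity elements, yet not all of them.
  -- A second, disjoint family of conjugates then leaves no room for the identity.
  have hcard : ∀ M : Subgroup G, M ≠ ⊥ → IsCoatom M →
      2 * Nat.card ((G ⧸ M) × {x : M // x ≠ 1}) ≥ Nat.card G ∧
      Nat.card ((G ⧸ M) × {x : M // x ≠ 1}) + 1 < Nat.card G := by
    intro M hM0 hM
    have h1 : Nat.card {x : M // x ≠ 1} + 1 = Nat.card M := by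
      rw [← Finite.card_option]
      exact Nat.card_congr (Equiv.optionSubtypeNe 1)
    have h2 : 1 < Nat.card M := by
      rw [Subgroup.one_lt_card_iff_ne_bot]; exact hM0
    have h3 : 1 < Nat.card (G ⧸ M) := Subgroup.one_lt_index_of_ne_top hM.1
    rw [Nat.card_prod, Subgroup.card_eq_card_quotient_mul_card_subgroup M, ← h1]
    constructor <;> nlinarith
  obtain ⟨x₀, hx₀⟩ : ∃ x : G, x ≠ 1 := by
    by_contra! h
    exact hG (@isNilpotent_of_subsingleton _ _ ⟨fun a b => (h a).trans (h b).symm⟩)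
  obtain ⟨M, hM, hxM⟩ := hcoatom x₀
  have hM0 : M ≠ ⊥ := fun h => hx₀ (by rwa [h, Subgroup.mem_bot] at hxM)
  obtain ⟨x, hx1, hx⟩ : ∃ x : G, x ≠ 1 ∧ x ∉ Set.range (F M) := by
    by_contra! h
    have hs : Function.Surjective (fun o : Option _ => o.elim 1 (F M)) := by
      intro x
      by_cases hx : x = 1
      · exact ⟨none, hx.symm⟩
      · obtain ⟨y, hy⟩ := h x hx
        exact ⟨some y, hy⟩
    have h1 := Nat.card_le_card_of_surjective _ hs
    rw [Finite.card_option] at h1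
    exact absurd h1 (hcard M hM0 hM).2.not_ge
  obtain ⟨N, hN, hxN⟩ := hcoatom x
  have hN0 : N ≠ ⊥ := fun h => hx1 (by rwa [h, Subgroup.mem_bot] at hxN)
  have hdisj : ∀ y z, F M y ≠ F N z := by
    intro y z h
    have := hF M N y z hM hN h
    have h1 := (hmem this (z.1.out * x * z.1.out⁻¹)).mpr (by simpa [mul_assoc] using hxN)
    set c := z.1.out⁻¹ * y.1.out with hc
    have h2 : c⁻¹ * x * c ∈ M := by simpa [hc, mul_assoc] using h1
    -- The chosen coset representative is `c * m`, so the element of `M` must be conjugated by `m`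
    -- to compensate.
    obtain ⟨m, hm⟩ := QuotientGroup.mk_out_eq_mul M c
    refine hx ⟨((c : G ⧸ M), ⟨⟨(m : G)⁻¹ * (c⁻¹ * x * c) * m,
      M.mul_mem (M.mul_mem (M.inv_mem m.2) h2) m.2⟩, ?_⟩), ?_⟩
    · intro h3
      have h4 : (m : G)⁻¹ * (c⁻¹ * x * c) * m = 1 := congrArg Subtype.val h3
      apply hx1
      have h5 : x = (c * m) * ((m : G)⁻¹ * (c⁻¹ * x * c) * m) * (c * m)⁻¹ := by group
      rw [h5, h4]; group
    · simp only [F]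
      rw [hm]; group
  let Φ : Option (((G ⧸ M) × {x : M // x ≠ 1}) ⊕ ((G ⧸ N) × {x : N // x ≠ 1})) → G :=
    fun o => o.elim 1 (Sum.elim (F M) (F N))
  have hΦ : Function.Injective Φ := by
    have hs : Function.Injective (Sum.elim (F M) (F N)) :=
      (hFinj M hM hM0).sumElim (hFinj N hN hN0) hdisj
    rintro (_ | a) (_ | b) hab
    · rfl
    · rcases b with b | b
      · exact absurd hab.symm (hF1 M b)
      · exact absurd hab.symm (hF1 N b)
    · rcases a with a | a
      · exact absurd hab (hF1 M a)
      · exact absurd hab (hF1 N a)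
    · exact congrArg some (hs hab)
  have := Nat.card_le_card_of_injective Φ hΦ
  rw [Finite.card_option, Nat.card_sum] at this
  have h1 := hcard M hM0 hM
  have h2 := hcard N hN0 hN
  omega

/-- In a finite group with trivial center, a nontrivial normal `p`-subgroup is not centralized by
all elements of prime power order prime to `p`. -/
theorem exists_not_commute {G : Type u} [Group G] [Finite G] (hZ : Subgroup.center G = ⊥)
    (A : Subgroup G) [A.Normal] (hA : A ≠ ⊥) {p : ℕ} [hp : Fact p.Prime] (hpA : IsPGroup p A) :
    ∃ q : ℕ, q.Prime ∧ p ≠ q ∧ ∃ (y : G) (k : ℕ), y ^ q ^ k = 1 ∧ ∃ x ∈ A, y * x ≠ x * y := by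
  by_contra! hcon
  let P : Sylow p G := default
  have hdvd : p ∣ Nat.card A := by
    rcases hpA.card_eq_or_dvd with h | h
    · exact absurd (Subgroup.eq_bot_of_card_eq A h) hA
    · exact h
  -- The `p`-group `P` acts on `A` by conjugation, `p` divides `|A|`, and `1` is fixed; so there is
  -- another fixed point.
  obtain ⟨x, hxA, hx1, hxP⟩ : ∃ x ∈ A, x ≠ 1 ∧ ∀ y ∈ (P : Subgroup G), y * x = x * y := by
    let φ : MulAction P A := MulAction.compHom A ((MulAut.conjNormal (H := A)).comp P.1.subtype)
    have hsmul : ∀ (y : P) (a : A), ((y • a : A) : G) = y * a * (y : G)⁻¹ := fun y a => by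
      change ((MulAut.conjNormal (H := A) (y : G) a : A) : G) = _
      simp
    have h1 : (1 : A) ∈ MulAction.fixedPoints P A := fun y => Subtype.ext (by simp [hsmul])
    obtain ⟨b, hb, hne⟩ := P.2.exists_fixed_point_of_prime_dvd_card_of_fixed_point A hdvd h1
    refine ⟨b, b.2, fun h => hne (Subtype.ext h.symm), fun y hy => ?_⟩
    have := congrArg Subtype.val (hb ⟨y, hy⟩)
    rw [hsmul] at this
    exact mul_inv_eq_iff_eq_mul.mp this
  have htop : Subgroup.centralizer {x} = (⊤ : Subgroup G) := by
    rw [← Subgroup.index_eq_one]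
    by_contra hne
    obtain ⟨r, hr, hri⟩ := Nat.exists_prime_and_dvd hne
    have : Fact r.Prime := ⟨hr⟩
    -- The centralizer of `x` contains a Sylow `r`-subgroup for every prime `r`, so no prime divides
    -- its index and `x` is central.
    obtain ⟨Q, hQ⟩ : ∃ Q : Sylow r G, (Q : Subgroup G) ≤ Subgroup.centralizer {x} := by
      by_cases hpr : p = r
      · subst hpr
        exact ⟨P, fun y hy => Subgroup.mem_centralizer_singleton_iff.mpr (hxP y hy)⟩
      · refine ⟨default, fun y hy => Subgroup.mem_centralizer_singleton_iff.mpr ?_⟩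
        obtain ⟨k, hk⟩ := (isPGroup_iff_pow_pow_eq_one.mp (default : Sylow r G).2) ⟨y, hy⟩
        exact hcon r hr hpr y k (congrArg Subtype.val hk) x hxA
    exact Q.not_dvd_index (hri.trans (Subgroup.index_dvd_of_le hQ))
  apply hx1
  rw [← Subgroup.mem_bot, ← hZ, Subgroup.mem_center_iff]
  intro y
  have : y ∈ Subgroup.centralizer {x} := htop ▸ Subgroup.mem_top y
  exact Subgroup.mem_centralizer_singleton_iff.mp this

/-- A finite group with trivial center and a nontrivial nilpotent normal subgroup has a nontrivial
elementary abelian normal subgroup. -/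
theorem exists_elementary_abelian {G : Type u} [Group G] [Finite G]
    (N : Subgroup G) [N.Normal] (hN : N ≠ ⊥) (hnil : IsNilpotent N) :
    ∃ (p : ℕ) (A : Subgroup G), p.Prime ∧ A.Normal ∧ A ≠ ⊥ ∧
      (∀ x ∈ A, ∀ y ∈ A, x * y = y * x) ∧ ∀ x ∈ A, x ^ p = 1 := by
  have : Nontrivial N := (Subgroup.nontrivial_iff_ne_bot N).mpr hN
  have hZ : Subgroup.center N ≠ ⊥ := Group.IsNilpotent.center_ne_bot N
  obtain ⟨p, hp, hdvd⟩ := Nat.exists_prime_and_dvd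
    (mt (Subgroup.eq_bot_of_card_eq _) hZ)
  have : Fact p.Prime := ⟨hp⟩
  obtain ⟨z, hz⟩ := exists_prime_orderOf_dvd_card' p hdvd
  let Z : Subgroup G := (Subgroup.center N).map N.subtype
  have hZn : Z.Normal := inferInstance
  have hZc : ∀ x ∈ Z, ∀ y ∈ Z, x * y = y * x := by
    rintro _ ⟨x, hx, rfl⟩ _ ⟨y, hy, rfl⟩
    exact congrArg Subtype.val (Subgroup.mem_center_iff.mp hy x)
  let A : Subgroup G :=
    { carrier := {x | x ∈ Z ∧ x ^ p = 1}
      mul_mem' := fun {a b} ha hb => ⟨Z.mul_mem ha.1 hb.1, by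
        have : Commute a b := hZc a ha.1 b hb.1
        rw [this.mul_pow, ha.2, hb.2, one_mul]⟩
      one_mem' := ⟨Z.one_mem, one_pow p⟩
      inv_mem' := fun {a} ha => ⟨Z.inv_mem ha.1, by rw [inv_pow, ha.2, inv_one]⟩ }
  refine ⟨p, A, hp, ⟨fun x hx g => ⟨hZn.conj_mem x hx.1 g, ?_⟩⟩, ?_,
    fun x hx y hy => hZc x hx.1 y hy.1, fun x hx => hx.2⟩
  · rw [conj_pow, hx.2]; simp
  · intro h
    have hzA : ((z : N) : G) ∈ A := ⟨⟨z, z.2, rfl⟩, by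
      have := pow_orderOf_eq_one z
      rw [hz] at this
      exact congrArg (fun w : Subgroup.center N => ((w : N) : G)) this⟩
    rw [h, Subgroup.mem_bot] at hzA
    have hz1 : z = 1 := Subtype.ext (Subtype.ext hzA)
    rw [hz1, orderOf_one] at hz
    exact hp.one_lt.ne hz

/-- The positive laws of a finite nonnilpotent group are balanced for some primes `p ≠ q`. -/
theorem exists_balanced (G : Type u) [Group G] [Finite G] (hG : ¬ IsNilpotent G) :
    ∃ p q : ℕ, p.Prime ∧ q.Prime ∧ ∀ (n : ℕ) (u v : List (Fin n)),
      WordLaw.Law G u v → WordLaw.Balanced p q u v := by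
  induction h : Nat.card G using Nat.strong_induction_on generalizing G with
  | _ m ih =>
  subst h
  -- Laws pass to quotients and subgroups, so induction leaves only trivial center with all proper
  -- subgroups nilpotent.
  by_cases hZ : Subgroup.center G = ⊥
  swap
  · have h1 : ¬ IsNilpotent (G ⧸ Subgroup.center G) := fun h => hG (Group.of_quotient_center_nilpotent h)
    have h2 : Nat.card (G ⧸ Subgroup.center G) < Nat.card G := by
      rw [Subgroup.card_eq_card_quotient_mul_card_subgroup (Subgroup.center G)]
      have := (Subgroup.one_lt_card_iff_ne_bot _).mpr hZ
      have h3 : 0 < Nat.card (G ⧸ Subgroup.center G) := Nat.card_pos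
      nlinarith
    obtain ⟨p, q, hp, hq, h⟩ := ih _ h2 _ h1 rfl
    exact ⟨p, q, hp, hq, fun n u v hl =>
      h n u v (hl.of_surjective _ (QuotientGroup.mk'_surjective _))⟩
  by_cases hsub : ∀ K : Subgroup G, K ≠ ⊤ → IsNilpotent K
  swap
  · push Not at hsub
    obtain ⟨K, hK, hnil⟩ := hsub
    have h2 : Nat.card K < Nat.card G := lt_of_le_of_ne (Subgroup.card_le_card_group K)
      (mt (Subgroup.card_eq_iff_eq_top K).mp hK)
    obtain ⟨p, q, hp, hq, h⟩ := ih _ h2 _ hnil rfl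
    exact ⟨p, q, hp, hq, fun n u v hl => h n u v (hl.of_injective _ K.subtype_injective)⟩
  obtain ⟨N, hN, hN0, hN1⟩ := exists_normal hG hsub
  obtain ⟨p, A, hp, hA, hA0, hcomm, hexp⟩ := exists_elementary_abelian N hN0 (hsub N hN1)
  have : Fact p.Prime := ⟨hp⟩
  have hpA : IsPGroup p A := isPGroup_iff_pow_pow_eq_one.mpr fun x =>
    ⟨1, Subtype.ext (by simpa using hexp x x.2)⟩
  obtain ⟨q, hq, hpq, y, k, hk, hne⟩ := exists_not_commute hZ A hA0 hpA
  have : Fact q.Prime := ⟨hq⟩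
  classical
  -- If `j + 1` is the least such exponent, `y ^ q ^ j` acts on `A` with order exactly `q`.
  have hex : ∃ k, ∀ x ∈ A, y ^ q ^ k * x = x * y ^ q ^ k := ⟨k, by simp [hk]⟩
  have hpos : Nat.find hex ≠ 0 := by
    intro h0
    obtain ⟨x, hx, hxy⟩ := hne
    have := Nat.find_spec hex x hx
    rw [h0, pow_zero, pow_one] at this
    exact hxy this
  obtain ⟨j, hj⟩ := Nat.exists_eq_succ_of_ne_zero hpos
  refine ⟨p, q, hp, hq, fun n u v hl =>
    hl.balanced_of_normal A hpq hcomm hexp (y ^ q ^ j) (fun x hx => ?_) ?_⟩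
  · have := Nat.find_spec hex x hx
    rw [hj, pow_succ, pow_mul] at this
    exact this
  · have := Nat.find_min hex (m := j) (by omega)
    push Not at this
    exact this

end MinimalNonnilpotent

/-! ### Identities of the one-sorted algebra -/

namespace UnivAlg

open FirstOrder.Language

/-- The term operation of `t` maps `x` to `((x i).1, (x W₁).1 ⋯ (x Wₖ).1 (x j).2)`. -/
def RealizesAs {α : Type*} (t : starLang.Term α) (i j : α) (W : List α)
    (A : TwoSorted.{u, v}) : Prop :=
  ∀ x : α → A.Star, t.realize x = ((x i).1, W.foldr (fun k y => A.op (x k).1 y) (x j).2)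

/-- `f` prepends a letter and `d` recombines coordinates. The two clauses share one `i`, `j`, `W`,
because the group action and the automaton live in different universes. -/
theorem exists_realizesAs {α : Type*} (t : starLang.Term α) :
    ∃ i j W, (∀ A : TwoSorted.{u, v}, RealizesAs t i j W A) ∧
      ∀ A : TwoSorted.{0, 0}, RealizesAs t i j W A := by
  induction t with
  | var i => exact ⟨i, i, [], fun A x => rfl, fun A x => rfl⟩
  | func F ts ih =>
    cases F with
    | f =>
      obtain ⟨i, j, W, h1, h2⟩ := ih 0
      refine ⟨i, j, i :: W, fun A x => ?_, fun A x => ?_⟩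
      · change (((ts 0).realize x).1, A.op ((ts 0).realize x).1 ((ts 0).realize x).2) = _
        rw [h1 A x]; rfl
      · change (((ts 0).realize x).1, A.op ((ts 0).realize x).1 ((ts 0).realize x).2) = _
        rw [h2 A x]; rfl
    | d =>
      obtain ⟨i, _, _, h1, h2⟩ := ih 0
      obtain ⟨_, j, W, h3, h4⟩ := ih 1
      refine ⟨i, j, W, fun A x => ?_, fun A x => ?_⟩
      · change (((ts 0).realize x).1, ((ts 1).realize x).2) = _
        rw [h1 A x, h3 A x]
      · change (((ts 0).realize x).1, ((ts 1).realize x).2) = _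
        rw [h2 A x, h4 A x]

theorem finite_starLang : Finite (Σ k, starLang.Functions k) := by
  let F : Bool → Σ k, starLang.Functions k := fun b => bif b then ⟨1, StarFunc.f⟩ else ⟨2, StarFunc.d⟩
  refine Finite.of_surjective F ?_
  rintro ⟨_, f | d⟩
  · exact ⟨true, rfl⟩
  · exact ⟨false, rfl⟩

theorem foldr_map₂_smul_coe {G : Type u} {S : Type v} [Group G] [MulAction G S] {α : Type*}
    (φ : α → G) (y : S) (W : List α) :
    W.foldr (fun k z => WithZero.map₂ (fun (g : G) (x : S) => g • x) (φ k : WithZero G) z)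
      (y : WithZero S) = (((W.map φ).prod • y : S) : WithZero S) := by
  induction W with
  | nil => simp
  | cons a W ih =>
    rw [List.foldr_cons, ih, List.map_cons, List.prod_cons, mul_smul]
    rfl

theorem foldr_map₂_smul_zero {G : Type u} {S : Type v} [Group G] [MulAction G S] {α : Type*}
    (φ : α → G) (W : List α) :
    W.foldr (fun k z => WithZero.map₂ (fun (g : G) (x : S) => g • x) (φ k : WithZero G) z)
      (0 : WithZero S) = 0 := by
  induction W with
  | nil => rfl
  | cons a W ih => rw [List.foldr_cons, ih]; rfl

/-- The identities of `A⁰(G, S, α)*` are trivial in the first variable and in the innermost second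
variable, and their words form positive laws of `G`. -/
theorem law_of_satisfies {G : Type u} {S : Type v} [Group G] [MulAction G S] [FaithfulSMul G S]
    [Nonempty S] {α : Type*} {s t : starLang.Term α}
    (h : Satisfies starLang (TwoSorted.ofAction G S).adjoinZero.Star s t)
    {i j i' j' : α} {W W' : List α}
    (hs : RealizesAs s i j W (TwoSorted.ofAction G S).adjoinZero)
    (ht : RealizesAs t i' j' W' (TwoSorted.ofAction G S).adjoinZero) :
    i = i' ∧ j = j' ∧ WordLaw.Law G W W' := by
  classical
  obtain ⟨y₀⟩ := ‹Nonempty S›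
  have key : ∀ x : α → (TwoSorted.ofAction G S).adjoinZero.Star, _ := fun x =>
    (hs x).symm.trans ((h x).trans (ht x))
  refine ⟨?_, ?_, fun φ => eq_of_smul_eq_smul (α := S) fun y => ?_⟩
  · by_contra hne
    have h1 := congrArg Prod.fst (key fun k => ((if k = i then 1 else 0 : WithZero G), (0 : WithZero S)))
    simp only [if_true, if_neg (Ne.symm hne)] at h1
    exact one_ne_zero (α := WithZero G) h1
  · by_contra hne
    -- With `0` at every variable other than `j`, a word ending in another variable evaluates to
    -- `0`, while one ending in `j` does not.
    let χ : α → WithZero S := fun k => if k = j then (y₀ : WithZero S) else 0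
    have hj : χ j = y₀ := if_pos rfl
    have hj' : χ j' = 0 := if_neg (Ne.symm hne)
    have h1 : W.foldr (fun _ z => WithZero.map₂ (fun (g : G) (x : S) => g • x)
        ((1 : G) : WithZero G) z) (χ j) = W'.foldr (fun _ z =>
        WithZero.map₂ (fun (g : G) (x : S) => g • x) ((1 : G) : WithZero G) z) (χ j') :=
      congrArg Prod.snd (key fun k => (((1 : G) : WithZero G), χ k))
    rw [hj, hj'] at h1
    have h2 := foldr_map₂_smul_coe (fun _ : α => (1 : G)) y₀ W
    have h3 := foldr_map₂_smul_zero (S := S) (fun _ : α => (1 : G)) W'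
    exact WithZero.coe_ne_zero (h2.symm.trans (h1.trans h3))
  · have h1 := congrArg Prod.snd (key fun k => ((φ k : WithZero G), (y : WithZero S)))
    have h2 := foldr_map₂_smul_coe φ y W
    have h3 := foldr_map₂_smul_coe φ y W'
    exact WithZero.coe_injective (h2.symm.trans (h1.trans h3))

/-! ### The automata -/

section Automaton

variable (p q N m : ℕ)

/-- The rotation of each row of `ℤ/p × ℤ/N`. -/
def rowRot : Equiv.Perm (ZMod p × ZMod N) :=
  Equiv.prodShear (Equiv.addRight 1) fun _ => Equiv.refl _

/-- The shift of the zeroth column of `ℤ/p × ℤ/N`. -/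
def colShift : Equiv.Perm (ZMod p × ZMod N) :=
  Equiv.prodShear (Equiv.refl _) fun i => if i = 0 then Equiv.addRight 1 else Equiv.refl _

/-- The permutations of `ℤ/p × ℤ/N` acting above the constant vectors. -/
def rot (z : ZMod q) : Equiv.Perm (ZMod p × ZMod N) :=
  if z = 0 then rowRot p N else
    if z = 1 then colShift p N * rowRot p N * (colShift p N)⁻¹ else 1

theorem rowRot_pow_apply (k : ℕ) (y : ZMod p × ZMod N) :
    (rowRot p N ^ k) y = (y.1 + k, y.2) := by
  induction k with
  | zero => simp
  | succ k ih =>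
    rw [pow_succ', Equiv.Perm.mul_apply, ih]
    simp [rowRot, add_assoc]

theorem rot_pow (z : ZMod q) : rot p q N z ^ p = 1 := by
  have h1 : rowRot p N ^ p = 1 := by
    ext y <;> simp [rowRot_pow_apply]
  unfold rot
  split_ifs
  · exact h1
  · rw [conj_pow, h1]; simp
  · exact one_pow p

open Classical in
/-- The transitions of an automaton: `some i` translates the vector in `(ℤ/q)^(m+1)`, and `none`
permutes `ℤ/p × ℤ/N` if this vector is constant. -/
noncomputable def transition (a : Option (Fin (m + 1)))
    (x : (ZMod p × ZMod N) × (Fin (m + 1) → ZMod q)) :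
    (ZMod p × ZMod N) × (Fin (m + 1) → ZMod q) :=
  match a with
  | some i => (x.1, Pi.single i 1 + x.2)
  | none => (if ∀ i, x.2 i = x.2 0 then rot p q N (x.2 0) x.1 else x.1, x.2)

/-- The automaton with transitions `transition`, as a 2-sorted algebra. -/
noncomputable def automaton : TwoSorted.{0, 0} where
  fst := Option (Fin (m + 1))
  snd := (ZMod p × ZMod N) × (Fin (m + 1) → ZMod q)
  op := transition p q N m

/-- Without the letter `some j`, coordinate `j` keeps the value `s j`, so only one constant vector
can be reached. Hence a single permutation is ever applied, once per `none` read at that vector. -/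
theorem foldr_transition [NeZero q] (j : Fin (m + 1)) (W : List (Option (Fin (m + 1))))
    (hW : some j ∉ W) (y : ZMod p × ZMod N) (s : Fin (m + 1) → ZMod q) :
    W.foldr (transition p q N m) (y, s) =
      ((rot p q N (s j) ^ WordLaw.occ q ((fun _ => s j) - s) W) y, WordLaw.shift q W + s) := by
  induction W with
  | nil => simp [WordLaw.occ, WordLaw.shift]
  | cons a W ih =>
    rw [List.mem_cons, not_or] at hW
    have hj : ∀ V : List (Option (Fin (m + 1))), some j ∉ V → WordLaw.shift q V j = 0 := by
      intro V
      induction V with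
      | nil => intro; rfl
      | cons b V ihV =>
        intro hV
        rw [List.mem_cons, not_or] at hV
        cases b with
        | none => exact ihV hV.2
        | some i =>
          have : j ≠ i := fun h => hV.1 (h ▸ rfl)
          simp [WordLaw.shift, ihV hV.2, Pi.single_eq_of_ne this]
    rw [List.foldr_cons, ih hW.2]
    cases a with
    | some i => simp [transition, WordLaw.occ, WordLaw.shift, add_assoc]
    | none =>
      set r := WordLaw.shift q W with hr
      have hrj : r j = 0 := hj W hW.2
      have hiff : (∀ i, (r + s) i = (r + s) 0) ↔ r = (fun _ => s j) - s := by
        rw [eq_sub_iff_add_eq]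
        constructor
        · intro h
          funext i
          rw [h i, ← h j, Pi.add_apply, hrj, zero_add]
        · intro h i
          rw [h]
      simp only [transition, WordLaw.occ, WordLaw.shift, ← hr, hiff]
      split_ifs with h
      · have h0 : (r + s) 0 = s j := by rw [h]; simp
        rw [h0, pow_succ', Equiv.Perm.mul_apply]
      · rfl

/-- This is transitivity: translations reach any vector, in particular the constant vectors `0` and
`1`, and the two permutations available there connect the whole grid. -/
theorem transition_induction [NeZero q] [NeZero N] [Fact p.Prime] [Fact q.Prime]
    (R : (ZMod p × ZMod N) × (Fin (m + 1) → ZMod q) → Prop) (h0 : R ((0, 0), 0))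
    (hR : ∀ a x, R x → R (transition p q N m a x)) (x) : R x := by
  have hshift : ∀ y s t, R (y, s) → R (y, t + s) := by
    let H : AddSubmonoid (Fin (m + 1) → ZMod q) :=
      { carrier := {t | ∀ y s, R (y, s) → R (y, t + s)}
        zero_mem' := fun y s h => by simpa using h
        add_mem' := fun {a b} ha hb y s h => by
          rw [add_assoc]; exact ha y _ (hb y s h) }
    intro y s t
    suffices t ∈ H from this y s
    rw [← Finset.univ_sum_single t]
    refine H.sum_mem fun i _ => ?_
    have h1 : Pi.single i 1 ∈ H := fun y s h => hR (some i) (y, s) h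
    have h2 : Pi.single i (t i) = (t i).val • (Pi.single i 1 : Fin (m + 1) → ZMod q) := by
      rw [← Pi.single_smul]; simp
    rw [h2]
    exact H.nsmul_mem h1 _
  have hmove : ∀ y s s', R (y, s) → R (y, s') := fun y s s' h => by
    simpa using hshift y s (s' - s) h
  have hrot : ∀ z y, R (y, 0) → R (rot p q N z y, 0) := fun z y h => by
    have := hR none (y, fun _ => z) (hmove _ _ _ h)
    refine hmove _ (fun _ => z) _ ?_
    simpa [transition] using this
  have hrow : ∀ i i' j, R ((i, j), 0) → R ((i', j), 0) := fun i i' j h => by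
    have h1 : ∀ k : ℕ, R ((i + k, j), 0) := by
      intro k
      induction k with
      | zero => simpa using h
      | succ k ih =>
        have := hrot 0 _ ih
        simpa [rot, rowRot, add_assoc] using this
    simpa using h1 (i' - i).val
  have hcol : ∀ j, R ((0, j), 0) → R ((0, j - 1), 0) := fun j h => by
    have h1 := hrot 1 _ h
    refine hrow 1 _ _ ?_
    -- `rot 1` takes `(0, j)` to `(0, j - 1)`, then to `(1, j - 1)`, which the final `colShift`
    -- fixes since `1 ≠ 0` mod `p`.
    have h2 : (colShift p N)⁻¹ (0, j) = (0, j - 1) := by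
      rw [Equiv.Perm.inv_eq_iff_eq]
      simp [colShift]
    simpa [rot, h2, rowRot, colShift, ← sub_eq_add_neg] using h1
  have hall : ∀ k : ℕ, R ((0, -(k : ZMod N)), 0) := by
    intro k
    induction k with
    | zero => simpa using h0
    | succ k ih =>
      have := hcol _ ih
      rwa [show -(k : ZMod N) - 1 = -((k + 1 : ℕ) : ZMod N) by push_cast; ring] at this
  obtain ⟨⟨i, j⟩, s⟩ := x
  refine hmove _ 0 _ (hrow 0 _ _ ?_)
  simpa using hall (-j).val

/-- One generator per letter, all at the same state: `f` performs a transition, and `d` then pairs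
the new state with any letter. -/
theorem automaton_isGeneratedBy [NeZero N] [Fact p.Prime] [Fact q.Prime] :
    IsGeneratedBy starLang (m + 2) (automaton p q N m).Star := by
  classical
  have : NeZero q := ⟨(Fact.out : q.Prime).ne_zero⟩
  let e : Option (Fin (m + 1)) → (automaton p q N m).Star := fun a => (a, ((0, 0), 0))
  let C := Substructure.closure starLang ((Finset.univ.image e : Finset _) : Set (automaton p q N m).Star)
  refine ⟨Finset.univ.image e, Finset.card_image_le.trans (by simp), ?_⟩
  change C = ⊤
  have hall : ∀ x a, ((a, x) : (automaton p q N m).Star) ∈ C := by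
    refine transition_induction p q N m _ (fun a => ?_) fun b x hx a => ?_
    · exact Substructure.subset_closure (Finset.mem_coe.mpr (Finset.mem_image_of_mem e (Finset.mem_univ (α := Option (Fin (m + 1))) a)))
    · have h1 := C.fun_mem StarFunc.f ![(b, x)] (by intro i; fin_cases i; exact hx b)
      exact C.fun_mem StarFunc.d ![(a, x), (b, (automaton p q N m).op b x)]
        (by intro i; fin_cases i; exacts [hx a, h1])
  exact eq_top_iff.mpr fun x _ => hall x.2 x.1

theorem automaton_memVarietyN {G : Type u} {S : Type v} [Group G] [MulAction G S]
    [FaithfulSMul G S] [Nonempty S] [NeZero q]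
    (h : ∀ u v : List (Fin m), WordLaw.Law G u v → WordLaw.Balanced p q u v) :
    MemVarietyN starLang (TwoSorted.ofAction G S).adjoinZero.Star m (automaton p q N m).Star := by
  intro s t hst x
  obtain ⟨i, j, W, hs, hs'⟩ := exists_realizesAs.{u, v} s
  obtain ⟨i', j', W', ht, ht'⟩ := exists_realizesAs.{u, v} t
  obtain ⟨rfl, rfl, hlaw⟩ := law_of_satisfies hst (hs _) (ht _)
  rw [hs' _ x, ht' _ x]
  let ρ : Fin m → Option (Fin (m + 1)) := fun k => (x k).1
  -- Only `m` letters are named by variables, so one of the `m + 1` translations is missing; this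
  -- makes `foldr_transition` applicable.
  obtain ⟨l, hl⟩ : ∃ l : Fin (m + 1), ∀ k, ρ k ≠ some l := by
    by_contra! hcon
    choose f hf using hcon
    have hinj : Function.Injective f := fun a b hab => by
      have := (hf a).symm.trans ((congrArg ρ hab).trans (hf b))
      exact Option.some.inj this
    simpa using Fintype.card_le_of_injective f hinj
  obtain ⟨hshift, hocc⟩ := h _ _ hlaw (m + 1) ρ
  let y : (ZMod p × ZMod N) × (Fin (m + 1) → ZMod q) := (x j).2
  have hfold : ∀ V : List (Fin m), V.foldr (fun k y => transition p q N m (ρ k) y) y =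
      (V.map ρ).foldr (transition p q N m) y := fun V => by
    rw [List.foldr_map]
  have hmem : ∀ V : List (Fin m), some l ∉ V.map ρ := fun V hV => by
    obtain ⟨k, _, hk⟩ := List.mem_map.mp hV
    exact hl k hk
  refine congrArg (Prod.mk (x i).1) ?_
  change W.foldr (fun k y => transition p q N m (ρ k) y) y =
    W'.foldr (fun k y => transition p q N m (ρ k) y) y
  rw [hfold, hfold]
  obtain ⟨y, r⟩ := y
  rw [foldr_transition p q N m l _ (hmem W), foldr_transition p q N m l _ (hmem W'), hshift]
  congr 2
  exact pow_eq_pow_iff_modEq.mpr ((hocc _).of_dvd (orderOf_dvd_of_pow_eq_one (rot_pow p q N _)))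

end Automaton

end UnivAlg

theorem theorem5p2 {G : Type u} {S : Type v} [Group G] [Finite G] [Finite S]
    [MulAction G S] [FaithfulSMul G S] (hG : ¬ Group.IsNilpotent G) :
    UnivAlg.IsINFBfin UnivAlg.starLang (UnivAlg.TwoSorted.ofAction G S).adjoinZero.Star := by
  have hS : Nonempty S := by
    by_contra hS
    rw [not_nonempty_iff] at hS
    have : Subsingleton G := ⟨fun a b => eq_of_smul_eq_smul (α := S) fun y => hS.elim y⟩
    exact hG inferInstance
  obtain ⟨p, q, hp, hq, hbal⟩ := MinimalNonnilpotent.exists_balanced G hG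
  have : Fact p.Prime := ⟨hp⟩
  have : Fact q.Prime := ⟨hq⟩
  have : NeZero q := ⟨hq.ne_zero⟩
  have : NeZero p := ⟨hp.ne_zero⟩
  refine ⟨UnivAlg.finite_starLang, inferInstanceAs (Finite (Option G × Option S)),
    fun n _ => ⟨n + 2, by omega, fun l => ?_⟩⟩
  -- The modulus `l + 1` is nonzero and gives at least `l` elements, while the `n + 2` generators do
  -- not depend on `l`.
  let B := UnivAlg.automaton p q (l + 1) n
  have hfin : Finite B.Star := inferInstanceAs (Finite (Option (Fin (n + 1)) ×
    ((ZMod p × ZMod (l + 1)) × (Fin (n + 1) → ZMod q))))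
  refine ⟨B.Star, UnivAlg.TwoSorted.starStructure B, hfin, ?_,
    UnivAlg.automaton_isGeneratedBy p q (l + 1) n,
    UnivAlg.automaton_memVarietyN p q (l + 1) n (hbal n)⟩
  let e : ZMod (l + 1) → B.Star := fun z => (none, ((0, z), 0))
  have hinj : Function.Injective e := fun a b hab => congrArg (fun w : B.Star => w.2.1.2) hab
  have := Nat.card_le_card_of_injective e hinj
  rw [Nat.card_zmod] at this
  exact (Nat.le_succ l).trans this
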